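/- Let $a<b$, write $L^2=L^2(a,b)$ (real-valued) with inner product $(\cdot,\cdot)$ and norm $\|\cdot\|$, let $B$ be its closed unit ball, and let $\partial$ be the (weak) derivative. Let $Kf(x)=\int_a^b K(x,y)f(y)\,dy$ be an integral operator on $L^2$ with a continuous or piecewise continuous (or, more generally, square integrable) kernel, and let $K^*$ be its adjoint. Put $A^0=\{u\in B: u\perp\ker K^*\}$, $A^0_*=\{u\in B:u\perp\ker K\}$, $A=A^1=K(B)$, $A_*=A^1_*=K^*(B)$, and $A^r=K(A^{r-1}_*)$, $A^r_*=K^*(A^{r-1})$ for $r\ge 2$. Assume $\partial K f=f$ for all $f\in A^r_*$ and $\partial K^* g=-g$ for all $g\in A^r$, $r\ge 0$. For a finite-dimensional subspace $\mathbb X\subset L^2$ with $L^2$-projector $X$ let $E(A,\mathbb X)=\sup_{u\in A}\|u-Xu\|$, and let $d_n(A)=\inf_{\dim\mathbb X=n}E(A,\mathbb X)$; $\mathbb X$ is called optimal for the $n$-width of $A$ if $\dim\mathbb X\le n$ and $E(A,\mathbb X)=d_n(A)$. Let $\mathbb X_0$ be optimal for the $n$-width of $A$, $\mathbb Y_0$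 optimal for the $n$-width of $A_*$, with $\mathbb X_0\perp\ker K^*$ and $\mathbb Y_0\perp\ker K$. For $p\ge1$ define $\mathbb X_p=K(\mathbb Y_{p-1})$, $\mathbb Y_p=K^*(\mathbb X_{p-1})$, let $Y_{p-1}$ be the $L^2$-projector onto $\mathbb Y_{p-1}$, and let $R_{\mathbb X_p}=KY_{p-1}\partial: K(L^2)\to\mathbb X_p$ be the Ritz projector. Consider the eigenvalue problem: find $0\ne\psi\in K(L^2)$, $\mu\in\mathbb R$ with $(\partial\psi,\partial v)=\mu(\psi,v)$ for all $v\in K(L^2)$; and its discretization: find $0\ne\psi_p\in\mathbb X_p$, $\mu_p\in\mathbb R$ with $(\partial\psi_p,\partial v)=\mu_p(\psi_p,v)$ for all $v\in\mathbb X_p$. Eigenvalues are listed increasingly with multiplicity. Let $\mu_1,\dots,\mu_{n+1}$ be the first $n+1$ eigenvalues of the former problem, with $L^2$-orthonormal eigenfunctions $\psi_1,\dots,\psi_{n+1}$, and $\mu_{p,1}\le\dots\le\mu_{p,n}$ the first $n$ eigenvalues of the latter, with $L^2$-orthonormal eigenfunctions $\psi_{p,1},\dots,\psi_{p,n}$.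 Assume $\mu_1<\dots<\mu_n<\mu_{n+1}$. Let $p\ge 1$ and $1\le l\le n$, let the sign of $\psi_{p,l}$ be chosen so that $(\psi_l,\psi_{p,l})\ge0$, and assume $\mu_{p,i}\ne\mu_l$ for all $i\in\{1,\dots,n\}$, $i\neq l$, so that the separation constant $$\rho_l=\max_{\substack{i=1,\dots,n\\ i\ne l}}\frac{\mu_l}{|\mu_l-\mu_{p,i}|}\qquad(\rho_1=0\text{ if }n=1)$$ is finite. Then $$\|\psi_l-\psi_{p,l}\|\le 2(1+\rho_l)\,\|\psi_l-R_{\mathbb X_p}\psi_l\|\le 2(1+\rho_l)\left(\frac{\mu_l}{\mu_{n+1}}\right)^{(p+1)/2}.$$ -/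

import Mathlib

open MeasureTheory Set

noncomputable section

namespace Galerkin

/-- Lebesgue measure on the interval `(a, b)`. -/
abbrev vol (a b : ℝ) : Measure ℝ := volume.restrict (Ioo a b)

/-- The real Hilbert space `L²(a, b)`. -/
abbrev L2 (a b : ℝ) : Type := Lp ℝ 2 (vol a b)

/-! ### Integral operators -/

/-- A square integrable kernel on `(a, b) × (a, b)`; continuous and piecewise continuous kernels
on the closed square are bounded and measurable, hence of this kind. -/
def IsKernel (a b : ℝ) (k : ℝ → ℝ → ℝ) : Prop :=
  MemLp (fun z : ℝ × ℝ => k z.1 z.2) 2 ((vol a b).prod (vol a b))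

/-- The function `x ↦ ∫ₐᵇ k(x, y) f(y) dy`. -/
def kernelIntegral (a b : ℝ) (k : ℝ → ℝ → ℝ) (f : ℝ → ℝ) (x : ℝ) : ℝ :=
  ∫ y, k x y * f y ∂(vol a b)

theorem IsKernel.ae_memLp {a b : ℝ} {k : ℝ → ℝ → ℝ} (hk : IsKernel a b k) :
    ∀ᵐ x ∂(vol a b), MemLp (k x) 2 (vol a b) := by
  have h2 := hk.integrable_norm_rpow (by norm_num) (by norm_num)
  filter_upwards [h2.prod_right_ae, hk.1.prodMk_left] with x hx hm
  exact (integrable_norm_rpow_iff hm (by norm_num) (by norm_num)).1 hx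

theorem IsKernel.aestronglyMeasurable {a b : ℝ} {k : ℝ → ℝ → ℝ} (hk : IsKernel a b k)
    (f : L2 a b) : AEStronglyMeasurable (kernelIntegral a b k f) (vol a b) := by
  have h : AEStronglyMeasurable (fun z : ℝ × ℝ => k z.1 z.2 * f z.2)
      ((vol a b).prod (vol a b)) := hk.1.mul (Lp.memLp f).1.comp_snd
  exact h.integral_prod_right'

theorem IsKernel.eLpNorm_le {a b : ℝ} {k : ℝ → ℝ → ℝ} (hk : IsKernel a b k) (f : L2 a b) :
    eLpNorm (kernelIntegral a b k f) 2 (vol a b) ≤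
      eLpNorm (fun z : ℝ × ℝ => k z.1 z.2) 2 ((vol a b).prod (vol a b)) *
        eLpNorm f 2 (vol a b) := by
  have key : ∀ᵐ x ∂(vol a b), ‖kernelIntegral a b k f x‖ₑ ≤
      eLpNorm (k x) 2 (vol a b) * eLpNorm f 2 (vol a b) := by
    filter_upwards [hk.ae_memLp] with x hx
    calc ‖kernelIntegral a b k f x‖ₑ ≤ ∫⁻ y, ‖k x y * f y‖ₑ ∂(vol a b) :=
          enorm_integral_le_lintegral_enorm _
      _ = eLpNorm (k x • (f : ℝ → ℝ)) 1 (vol a b) := by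
          rw [eLpNorm_one_eq_lintegral_enorm]; rfl
      _ ≤ _ := eLpNorm_smul_le_mul_eLpNorm (Lp.memLp f).1 hx.1
  have two : ∀ {α : Type} [MeasurableSpace α] (ν : Measure α) (g : α → ℝ),
      eLpNorm g 2 ν = (∫⁻ x, ‖g x‖ₑ ^ (2 : ℝ) ∂ν) ^ (1 / 2 : ℝ) := by
    intro α _ ν g
    rw [eLpNorm_eq_lintegral_rpow_enorm_toReal (by norm_num) (by norm_num)]
    norm_num
  have sq : ∀ {α : Type} [MeasurableSpace α] (ν : Measure α) (g : α → ℝ),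
      eLpNorm g 2 ν ^ (2 : ℝ) = ∫⁻ x, ‖g x‖ₑ ^ (2 : ℝ) ∂ν := by
    intro α _ ν g
    rw [two, ← ENNReal.rpow_mul]
    norm_num
  rw [← ENNReal.rpow_le_rpow_iff (z := 2) (by norm_num),
    ENNReal.mul_rpow_of_nonneg _ _ (by norm_num), sq, sq (_ : Measure (ℝ × ℝ)),
    lintegral_prod _ (hk.1.enorm.pow_const _)]
  have hfin : eLpNorm f 2 (vol a b) ^ (2 : ℝ) ≠ ⊤ :=
    ENNReal.rpow_ne_top_of_nonneg (by norm_num) (Lp.memLp f).2.ne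
  rw [← lintegral_mul_const' _ _ hfin]
  refine lintegral_mono_ae ?_
  filter_upwards [key] with x hx
  calc ‖kernelIntegral a b k f x‖ₑ ^ (2 : ℝ)
      ≤ (eLpNorm (k x) 2 (vol a b) * eLpNorm f 2 (vol a b)) ^ (2 : ℝ) :=
        ENNReal.rpow_le_rpow hx (by norm_num)
    _ = _ := by rw [ENNReal.mul_rpow_of_nonneg _ _ (by norm_num), sq _ (k x)]

theorem IsKernel.memLp {a b : ℝ} {k : ℝ → ℝ → ℝ} (hk : IsKernel a b k) (f : L2 a b) :
    MemLp (kernelIntegral a b k f) 2 (vol a b) :=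
  ⟨hk.aestronglyMeasurable f,
    (hk.eLpNorm_le f).trans_lt (ENNReal.mul_lt_top hk.2 (Lp.memLp f).2)⟩

theorem IsKernel.ae_integrable {a b : ℝ} {k : ℝ → ℝ → ℝ} (hk : IsKernel a b k) (f : L2 a b) :
    ∀ᵐ x ∂(vol a b), Integrable (fun y => k x y * f y) (vol a b) := by
  filter_upwards [hk.ae_memLp] with x hx
  exact hx.integrable_mul (Lp.memLp f)

/-- The integral operator `K f (x) = ∫ₐᵇ k(x, y) f(y) dy` on `L²(a, b)`. -/
def integralOp {a b : ℝ} (k : ℝ → ℝ → ℝ) (hk : IsKernel a b k) : L2 a b →L[ℝ] L2 a b :=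
  LinearMap.mkContinuous
    { toFun := fun f => (hk.memLp f).toLp _
      map_add' := by
        intro f g
        rw [← MemLp.toLp_add (hk.memLp f) (hk.memLp g)]
        refine MemLp.toLp_congr _ _ ?_
        filter_upwards [hk.ae_integrable f, hk.ae_integrable g] with x hf hg
        simp only [kernelIntegral, Pi.add_apply]
        rw [← integral_add hf hg]
        refine integral_congr_ae ?_
        filter_upwards [Lp.coeFn_add f g] with y hy
        rw [hy, Pi.add_apply, mul_add]
      map_smul' := by
        intro c f
        rw [RingHom.id_apply, ← MemLp.toLp_const_smul c (hk.memLp f)]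
        refine MemLp.toLp_congr _ _ (Filter.Eventually.of_forall fun x => ?_)
        simp only [kernelIntegral, Pi.smul_apply, smul_eq_mul]
        rw [← integral_const_mul]
        refine integral_congr_ae ?_
        filter_upwards [Lp.coeFn_smul c f] with y hy
        rw [hy, Pi.smul_apply, smul_eq_mul]
        ring }
    (eLpNorm (fun z : ℝ × ℝ => k z.1 z.2) 2 ((vol a b).prod (vol a b))).toReal
    (by
      intro f
      simp only [LinearMap.coe_mk, AddHom.coe_mk, Lp.norm_toLp]
      rw [Lp.norm_def, ← ENNReal.toReal_mul]
      exact ENNReal.toReal_mono (ENNReal.mul_lt_top hk.2 (Lp.memLp f).2).ne (hk.eLpNorm_le f))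

theorem integralOp_ae_eq {a b : ℝ} (k : ℝ → ℝ → ℝ) (hk : IsKernel a b k) (f : L2 a b) :
    integralOp k hk f =ᵐ[vol a b] fun x => ∫ y, k x y * f y ∂(vol a b) :=
  (hk.memLp f).coeFn_toLp

/-- The adjoint operator, `(f, K* g) = (K f, g)`. -/
abbrev dual {a b : ℝ} (K : L2 a b →L[ℝ] L2 a b) : L2 a b →L[ℝ] L2 a b :=
  ContinuousLinearMap.adjoint K

/-! ### The derivative `∂` -/

/-- `w ∈ L²(a, b)` is the (weak) derivative of `u ∈ L²(a, b)`. -/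
def HasWeakDeriv {a b : ℝ} (u w : L2 a b) : Prop :=
  ∀ φ : ℝ → ℝ, ContDiff ℝ (⊤ : ℕ∞) φ → HasCompactSupport φ → tsupport φ ⊆ Ioo a b →
    ∫ x, u x * deriv φ x ∂(vol a b) = -∫ x, w x * φ x ∂(vol a b)

theorem HasWeakDeriv.unique {a b : ℝ} {u w w' : L2 a b} (h : HasWeakDeriv u w)
    (h' : HasWeakDeriv u w') : w = w' := by
  have hi : ∀ v : L2 a b, LocallyIntegrableOn v (Ioo a b) volume := by
    intro v
    have : IntegrableOn v (Ioo a b) volume := (Lp.memLp v).integrable (by norm_num)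
    exact this.locallyIntegrableOn
  have key := isOpen_Ioo.ae_eq_zero_of_integral_contDiff_smul_eq_zero
    ((hi w).sub (hi w')) (fun g hg hc hs => ?_)
  · refine Lp.ext ?_
    rw [Filter.EventuallyEq, ae_restrict_iff' measurableSet_Ioo]
    filter_upwards [key] with x hx hxs
    exact sub_eq_zero.1 (hx hxs)
  · have hint : ∀ v : L2 a b, Integrable (fun x => v x * g x) (vol a b) := by
      intro v
      have hv : Integrable v (vol a b) := (Lp.memLp v).integrable (by norm_num)
      obtain ⟨C, hC⟩ := hc.exists_bound_of_continuous hg.continuous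
      exact hv.mul_bdd (c := C) hg.continuous.aestronglyMeasurable
        (Filter.Eventually.of_forall hC)
    have hz : ∀ x, x ∉ Ioo a b → g x • ((w : ℝ → ℝ) - (w' : ℝ → ℝ)) x = 0 := by
      intro x hx
      have : g x = 0 := by
        by_contra hne
        exact hx (hs (subset_tsupport g hne))
      simp [this]
    rw [← setIntegral_eq_integral_of_forall_compl_eq_zero hz]
    have e : ∀ x, g x • ((w : ℝ → ℝ) - (w' : ℝ → ℝ)) x = w x * g x - w' x * g x := by
      intro x
      simp only [Pi.sub_apply, smul_eq_mul]
      ring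
    simp only [e]
    rw [integral_sub (hint w) (hint w')]
    have h1 := h g hg hc hs
    have h2 := h' g hg hc hs
    linarith

open Classical in
/-- The derivative `∂ u`, for `u` with a (necessarily unique) weak derivative in `L²(a, b)`. -/
def weakDeriv {a b : ℝ} (u : L2 a b) : L2 a b :=
  if h : ∃ w, HasWeakDeriv u w then h.choose else 0

theorem HasWeakDeriv.weakDeriv_eq {a b : ℝ} {u w : L2 a b} (h : HasWeakDeriv u w) :
    weakDeriv u = w := by
  have hex : ∃ w, HasWeakDeriv u w := ⟨w, h⟩
  rw [weakDeriv, dif_pos hex]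
  exact hex.choose_spec.unique h

/-! ### Kolmogorov widths and optimal subspaces -/

/-- The distance `E(A, X) = sup_{u ∈ A} ‖u - X u‖`, where `X u` is the `L²`-projection of `u`
onto the finite-dimensional subspace `X`. -/
def distTo {a b : ℝ} (A : Set (L2 a b)) (X : Submodule ℝ (L2 a b)) [FiniteDimensional ℝ X] :
    ENNReal :=
  ⨆ u ∈ A, ‖u - X.starProjection u‖ₑ

/-- The Kolmogorov `n`-width `d_n(A) = inf_{dim X = n} E(A, X)`. -/
def nWidth {a b : ℝ} (n : ℕ) (A : Set (L2 a b)) : ENNReal :=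
  ⨅ (X : Submodule ℝ (L2 a b)) (_ : FiniteDimensional ℝ X) (_ : Module.finrank ℝ X = n),
    distTo A X

/-- `X` is an optimal subspace for `d_n(A)`. -/
def IsOptimal {a b : ℝ} (n : ℕ) (A : Set (L2 a b)) (X : Submodule ℝ (L2 a b))
    [FiniteDimensional ℝ X] : Prop :=
  Module.finrank ℝ X ≤ n ∧ nWidth n A = distTo A X

/-! ### The function classes and the approximation spaces -/

/-- The closed unit ball `B` of `L²(a, b)`. -/
def unitBall (a b : ℝ) : Set (L2 a b) := Metric.closedBall 0 1

/-- The pair `(Aʳ, Aʳ_*)`: `A⁰ = {u ∈ B : u ⟂ ker K*}`, `A¹ = K(B)`, `Aʳ = K(Aʳ⁻¹_*)` for `r ≥ 2`,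
and the same with the roles of `K` and `K*` exchanged. -/
def classes {a b : ℝ} (K : L2 a b →L[ℝ] L2 a b) : ℕ → Set (L2 a b) × Set (L2 a b)
  | 0 => ({u | u ∈ unitBall a b ∧ ∀ w, dual K w = 0 → inner ℝ u w = 0},
          {u | u ∈ unitBall a b ∧ ∀ w, K w = 0 → inner ℝ u w = 0})
  | 1 => (K '' unitBall a b, dual K '' unitBall a b)
  | r + 2 => (K '' (classes K (r + 1)).2, dual K '' (classes K (r + 1)).1)

/-- The class `Aʳ`. -/
def classA {a b : ℝ} (K : L2 a b →L[ℝ] L2 a b) (r : ℕ) : Set (L2 a b) := (classes K r).1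

/-- The class `Aʳ_*`. -/
def classAStar {a b : ℝ} (K : L2 a b →L[ℝ] L2 a b) (r : ℕ) : Set (L2 a b) := (classes K r).2

/-- The pair `(X_p, Y_p)`: `X_p = K(Y_{p-1})`, `Y_p = K*(X_{p-1})` for `p ≥ 1`. -/
def spaces {a b : ℝ} (K : L2 a b →L[ℝ] L2 a b) (X₀ Y₀ : Submodule ℝ (L2 a b)) :
    ℕ → Submodule ℝ (L2 a b) × Submodule ℝ (L2 a b)
  | 0 => (X₀, Y₀)
  | p + 1 => ((spaces K X₀ Y₀ p).2.map (K : L2 a b →ₗ[ℝ] L2 a b),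
              (spaces K X₀ Y₀ p).1.map (dual K : L2 a b →ₗ[ℝ] L2 a b))

/-- The space `X_p`. -/
def spaceX {a b : ℝ} (K : L2 a b →L[ℝ] L2 a b) (X₀ Y₀ : Submodule ℝ (L2 a b)) (p : ℕ) :
    Submodule ℝ (L2 a b) := (spaces K X₀ Y₀ p).1

/-- The space `Y_p`. -/
def spaceY {a b : ℝ} (K : L2 a b →L[ℝ] L2 a b) (X₀ Y₀ : Submodule ℝ (L2 a b)) (p : ℕ) :
    Submodule ℝ (L2 a b) := (spaces K X₀ Y₀ p).2

theorem spaces_finiteDimensional {a b : ℝ} (K : L2 a b →L[ℝ] L2 a b)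
    (X₀ Y₀ : Submodule ℝ (L2 a b)) [FiniteDimensional ℝ X₀] [FiniteDimensional ℝ Y₀] (p : ℕ) :
    FiniteDimensional ℝ (spaces K X₀ Y₀ p).1 ∧ FiniteDimensional ℝ (spaces K X₀ Y₀ p).2 := by
  induction p with
  | zero => exact ⟨‹_›, ‹_›⟩
  | succ p ih =>
    obtain ⟨h1, h2⟩ := ih
    exact ⟨FiniteDimensional.of_surjective _
        (LinearMap.submoduleMap_surjective (K : L2 a b →ₗ[ℝ] L2 a b) (spaces K X₀ Y₀ p).2),
      FiniteDimensional.of_surjective _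
        (LinearMap.submoduleMap_surjective (dual K : L2 a b →ₗ[ℝ] L2 a b) (spaces K X₀ Y₀ p).1)⟩

instance spaceX_finiteDimensional {a b : ℝ} (K : L2 a b →L[ℝ] L2 a b)
    (X₀ Y₀ : Submodule ℝ (L2 a b)) [FiniteDimensional ℝ X₀] [FiniteDimensional ℝ Y₀] (p : ℕ) :
    FiniteDimensional ℝ (spaceX K X₀ Y₀ p) := (spaces_finiteDimensional K X₀ Y₀ p).1

instance spaceY_finiteDimensional {a b : ℝ} (K : L2 a b →L[ℝ] L2 a b)
    (X₀ Y₀ : Submodule ℝ (L2 a b)) [FiniteDimensional ℝ X₀] [FiniteDimensional ℝ Y₀] (p : ℕ) :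
    FiniteDimensional ℝ (spaceY K X₀ Y₀ p) := (spaces_finiteDimensional K X₀ Y₀ p).2

/-- `∂ K = I` on all classes `Aʳ_*` and `∂ K* = -I` on all classes `Aʳ`, `r ≥ 0`. -/
def DerivInverts {a b : ℝ} (K : L2 a b →L[ℝ] L2 a b) : Prop :=
  (∀ r : ℕ, ∀ f ∈ classAStar K r, HasWeakDeriv (K f) f) ∧
  (∀ r : ℕ, ∀ g ∈ classA K r, HasWeakDeriv (dual K g) (-g))

/-- The Ritz projection `R_{X_p} = K Y_{p-1} ∂` (for `p ≥ 1`, on the range of `K`), where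
`Y_{p-1}` is the `L²`-projector onto the space `Y_{p-1}`. -/
def ritzX {a b : ℝ} (K : L2 a b →L[ℝ] L2 a b) (X₀ Y₀ : Submodule ℝ (L2 a b))
    [FiniteDimensional ℝ X₀] [FiniteDimensional ℝ Y₀] (p : ℕ) (u : L2 a b) : L2 a b :=
  K ((spaceY K X₀ Y₀ (p - 1)).starProjection (weakDeriv u))

/-! ### Eigenvalue problems -/

/-- `ψ ∈ V`, `ψ ≠ 0`, solves `(∂ψ, ∂v) = μ (ψ, v)` for all `v ∈ V`. -/
def IsEigenpair {a b : ℝ} (V : Submodule ℝ (L2 a b)) (μ : ℝ) (ψ : L2 a b) : Prop :=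
  ψ ∈ V ∧ ψ ≠ 0 ∧ ∀ v ∈ V, inner ℝ (weakDeriv ψ) (weakDeriv v) = μ * inner ℝ ψ v

/-- `μ 0 ≤ … ≤ μ (m - 1)` are the first `m` eigenvalues of the problem on `V`, in increasing
order and counted with multiplicity, and `ψ 0, …, ψ (m - 1)` are `L²`-orthonormal eigenfunctions
for them: nothing is skipped, i.e. an eigenfunction orthogonal to all `ψ i` does not belong to an
eigenvalue smaller than one of the `μ i`. -/
structure IsFirstEigenpairs {a b : ℝ} (V : Submodule ℝ (L2 a b)) (m : ℕ) (μ : Fin m → ℝ)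
    (ψ : Fin m → L2 a b) : Prop where
  mono : Monotone μ
  orthonormal : Orthonormal ℝ ψ
  eigenpair : ∀ i, IsEigenpair V (μ i) (ψ i)
  first : ∀ (ν : ℝ) (χ : L2 a b), IsEigenpair V ν χ → (∀ i, inner ℝ (ψ i) χ = 0) → ∀ i, μ i ≤ ν

/-- The separation constant `ρ_l = max_{i ≠ l} μ_l / |μ_l - μ_{p,i}|`, where `m` stands for `μ_l`
and `μp` for the discrete eigenvalues; it is `0` if there is no `i ≠ l`. -/
def separationConst {n : ℕ} (m : ℝ) (μp : Fin n → ℝ) (l : Fin n) : ℝ :=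
  ⨆ i : {i : Fin n // i ≠ l}, m / |m - μp i|

end Galerkin

end

noncomputable section

namespace Galerkin


/-! ### Compactness of square summable operators -/

section HilbertSchmidt

variable {H F : Type*} [NormedAddCommGroup H] [InnerProductSpace ℝ H]
  [NormedAddCommGroup F] [NormedSpace ℝ F]

/-! On `(ker K)ᗮ` the derivative inverts `K`, so an exact eigenfunction satisfies `∂ψ = μ K*ψ` and
`ψ = μ K K*ψ`. The exact problem is thus the spectral problem of `K K*` with nonzero eigenvalues
`1/μ`, and `φ = √μ K*ψ` is the singular partner of `ψ`.

For the first inequality, Galerkin orthogonality (`inner_ritzX_eq`) gives `(μ_{p,i} - μ_l)(ψ_{p,i},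
Rψ_l) = μ_l (ψ_{p,i}, ψ_l - Rψ_l)`. Since `dim X_p ≤ n`, the `n` discrete eigenfunctions span `X_p`;
by Bessel the part of `Rψ_l` off `ψ_{p,l}` is at most `ρ_l ‖ψ_l - Rψ_l‖`. Normalizing length and
sign costs the factor 2 (`norm_sub_le_of_coeff_le`).

For the second, `K` is Hilbert–Schmidt, hence compact, so `‖(I - Z) K‖²` for `Z` the span of the
first `n` eigenfunctions is zero or an eigenvalue of `K K*` on `Zᗮ`, and is at most `1/μ_{n+1}`.
Hence `d = μ_{n+1}^{-1/2}` bounds the width of `A`, likewise that of `A_*`; optimal spaces inherit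
the bound. As `I - Y` is idempotent and `‖K(I - Y)‖ = ‖(I - Y)K*‖`, passing from `Y` to `K(Y)` keeps
the bound `d` and gains a factor `d` in the error. Iterating along `ψ = √μ Kφ`, `φ = √μ K*ψ` gives
`(√μ d)^(p+1)`. -/

theorem isCompactOperator_smulRight (φ : H →L[ℝ] ℝ) (y : F) :
    IsCompactOperator (φ.smulRight y) :=
  (isCompactOperator_of_locallyCompactSpace_rng ((1 : ℝ →L[ℝ] ℝ).smulRight y)).comp_clm φ

/-- The part of an operator that belongs to finitely many vectors of an orthonormal family is
bounded by their Hilbert–Schmidt norm. -/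
theorem norm_sum_smulRight_le {ι : Type*} {v : ι → H} (hv : Orthonormal ℝ v) (y : ι → F)
    (s : Finset ι) :
    ‖∑ i ∈ s, (innerSL ℝ (v i)).smulRight (y i)‖ ≤ √(∑ i ∈ s, ‖y i‖ ^ 2) := by
  refine ContinuousLinearMap.opNorm_le_bound _ (Real.sqrt_nonneg _) fun f => ?_
  rw [sum_apply]
  calc ‖∑ i ∈ s, (innerSL ℝ (v i)).smulRight (y i) f‖
      ≤ ∑ i ∈ s, ‖y i‖ * ‖inner ℝ (v i) f‖ := by
        refine norm_sum_le_of_le _ fun i _ => ?_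
        simp [norm_smul, mul_comm]
    _ ≤ √(∑ i ∈ s, ‖y i‖ ^ 2) * √(∑ i ∈ s, ‖inner ℝ (v i) f‖ ^ 2) :=
        Real.sum_mul_le_sqrt_mul_sqrt _ _ _
    _ ≤ √(∑ i ∈ s, ‖y i‖ ^ 2) * ‖f‖ := by
        gcongr
        exact Real.sqrt_le_iff.2 ⟨norm_nonneg _, hv.sum_inner_products_le f⟩

/-- An operator that is square summable over an orthonormal basis is compact. -/
theorem isCompactOperator_of_summable [CompleteSpace F] {ι : Type*}
    (e : HilbertBasis ι ℝ H) (K : H →L[ℝ] F) (hK : Summable fun i => ‖K (e i)‖ ^ 2) :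
    IsCompactOperator K := by
  -- Cauchy criterion in operator norm: finite blocks of the expansion are controlled by the tails
  -- of the Hilbert–Schmidt sum, so the finite rank partial sums converge in norm.
  have hs : Summable fun i => (innerSL ℝ (e i)).smulRight (K (e i)) := by
    rw [summable_iff_vanishing_norm] at hK ⊢
    intro ε hε
    obtain ⟨s, hs⟩ := hK (ε ^ 2) (by positivity)
    refine ⟨s, fun t ht => ?_⟩
    refine (norm_sum_smulRight_le e.orthonormal _ t).trans_lt ?_
    rw [Real.sqrt_lt' hε]
    exact (le_abs_self _).trans_lt (hs t ht)
  have hsum : HasSum (fun i => (innerSL ℝ (e i)).smulRight (K (e i))) K := by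
    have h := hs.hasSum
    convert h
    ext f
    have h1 := h.mapL (ContinuousLinearMap.apply ℝ F f)
    have h2 := (e.hasSum_repr f).mapL K
    refine h2.unique ?_
    convert h1 using 2 with i
    · simp [e.repr_apply_apply]
    · rfl
  refine isCompactOperator_of_tendsto hsum (Filter.Eventually.of_forall fun s => ?_)
  exact Submodule.sum_mem (compactOperator (RingHom.id ℝ) H F)
    fun i _ => isCompactOperator_smulRight _ _

end HilbertSchmidt

/-- For almost every `x`, the value at `x` of the image of `v i` is the coefficient `(v i, k(x,
·))`; Bessel's inequality for `k(x, ·)` is then integrated in `x`. -/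
theorem IsKernel.sum_norm_integralOp_sq_le {a b : ℝ} {k : ℝ → ℝ → ℝ} (hk : IsKernel a b k)
    {ι : Type*} {v : ι → L2 a b} (hv : Orthonormal ℝ v) (s : Finset ι) :
    ∑ i ∈ s, ‖integralOp k hk (v i)‖ ^ 2 ≤
      ∫ x, (∫ y, ‖k x y‖ ^ 2 ∂(vol a b)) ∂(vol a b) := by
  have hsq : ∀ i, ‖integralOp k hk (v i)‖ ^ 2 =
      ∫ x, ‖kernelIntegral a b k (v i) x‖ ^ 2 ∂(vol a b) := by
    intro i
    rw [← real_inner_self_eq_norm_sq, L2.inner_def]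
    refine integral_congr_ae ?_
    filter_upwards [integralOp_ae_eq k hk (v i)] with x hx
    rw [hx, real_inner_self_eq_norm_sq]
    rfl
  have hint : Integrable (fun z : ℝ × ℝ => ‖k z.1 z.2‖ ^ 2) ((vol a b).prod (vol a b)) := by
    exact_mod_cast hk.integrable_norm_pow (p := 2) (by norm_num)
  have hint' : ∀ i, Integrable (fun x => ‖kernelIntegral a b k (v i) x‖ ^ 2) (vol a b) :=
    fun i => by exact_mod_cast (hk.memLp (v i)).integrable_norm_pow (p := 2) (by norm_num)
  simp only [hsq]
  rw [← integral_finsetSum s fun i _ => hint' i]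
  refine integral_mono_ae (integrable_finsetSum s fun i _ => hint' i) hint.integral_prod_left ?_
  filter_upwards [hk.ae_memLp] with x hx
  have hinner : ∀ i, kernelIntegral a b k (v i) x = inner ℝ (v i) (hx.toLp _) := by
    intro i
    rw [L2.inner_def]
    refine integral_congr_ae ?_
    filter_upwards [hx.coeFn_toLp] with y hy
    rw [hy]
    rfl
  have hnorm : ∫ y, ‖k x y‖ ^ 2 ∂(vol a b) = ‖hx.toLp (k x)‖ ^ 2 := by
    rw [← real_inner_self_eq_norm_sq, L2.inner_def]
    refine integral_congr_ae ?_
    filter_upwards [hx.coeFn_toLp] with y hy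
    rw [hy, real_inner_self_eq_norm_sq]
  simp only [hinner, hnorm]
  exact hv.sum_inner_products_le _

theorem isCompactOperator_integralOp {a b : ℝ} (k : ℝ → ℝ → ℝ) (hk : IsKernel a b k) :
    IsCompactOperator (integralOp k hk) := by
  obtain ⟨w, e, -⟩ := exists_hilbertBasis ℝ (L2 a b)
  exact isCompactOperator_of_summable e _ (summable_of_sum_le (fun _ => by positivity)
    (hk.sum_norm_integralOp_sq_le e.orthonormal))


/-! ### Projections and quasi-optimality in Hilbert space -/

section Hilbert

variable {H : Type*} [NormedAddCommGroup H] [InnerProductSpace ℝ H]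

theorem norm_sub_starProjection_le (U : Submodule ℝ H) [U.HasOrthogonalProjection] (u : H)
    {v : H} (hv : v ∈ U) : ‖u - U.starProjection u‖ ≤ ‖u - v‖ := by
  rw [Submodule.starProjection_minimal]
  exact ciInf_le (f := fun w : U => ‖u - w‖) ⟨0, by rintro _ ⟨w, rfl⟩; positivity⟩ ⟨v, hv⟩

theorem norm_sub_starProjection_le_norm (U : Submodule ℝ H) [U.HasOrthogonalProjection] (u : H) :
    ‖u - U.starProjection u‖ ≤ ‖u‖ := by
  simpa using norm_sub_starProjection_le U u U.zero_mem

theorem inner_sub_starProjection (U : Submodule ℝ H) [U.HasOrthogonalProjection] (u w : H) :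
    inner ℝ (u - U.starProjection u) w =
      inner ℝ (u - U.starProjection u) (w - U.starProjection w) := by
  rw [inner_sub_right, U.starProjection_inner_eq_zero u _ (U.starProjection_apply_mem w), sub_zero]

/-- A quasi-optimality estimate for an approximation from a subspace: the error in `e l` is
controlled by any `w` in the span of `e` whose remaining coefficients are small. -/
theorem norm_sub_le_of_coeff_le {n : ℕ} {e : Fin n → H} (he : Orthonormal ℝ e) (l : Fin n)
    {u w : H} (hu : ‖u‖ = 1) (hw : w ∈ Submodule.span ℝ (range e)) {ρ : ℝ} (hρ : 0 ≤ ρ)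
    (hcoeff : ∀ i, i ≠ l → |inner ℝ (e i) w| ≤ ρ * |inner ℝ (e i) (u - w)|)
    (hsign : 0 ≤ inner ℝ u (e l)) : ‖u - e l‖ ≤ 2 * (1 + ρ) * ‖u - w‖ := by
  obtain ⟨c, rfl⟩ := (Submodule.mem_span_range_iff_exists_fun ℝ).1 hw
  set w := ∑ i, c i • e i
  have hc : ∀ i, inner ℝ (e i) w = c i := fun i => he.inner_right_fintype c i
  have hrest : ‖w - c l • e l‖ ≤ ρ * ‖u - w‖ := by
    have h1 : w - c l • e l = ∑ i ∈ Finset.univ.erase l, c i • e i := by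
      rw [sub_eq_iff_eq_add, Finset.sum_erase_add _ _ (Finset.mem_univ l)]
    have h2 : ‖w - c l • e l‖ ^ 2 = ∑ i ∈ Finset.univ.erase l, c i ^ 2 := by
      rw [h1, ← real_inner_self_eq_norm_sq, he.inner_sum]
      simp [sq]
    refine abs_le_of_sq_le_sq' ?_ (by positivity) |>.2
    rw [h2, mul_pow]
    calc ∑ i ∈ Finset.univ.erase l, c i ^ 2
        ≤ ∑ i ∈ Finset.univ.erase l, ρ ^ 2 * ‖inner ℝ (e i) (u - w)‖ ^ 2 := by
          refine Finset.sum_le_sum fun i hi => ?_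
          have h := hcoeff i (Finset.ne_of_mem_erase hi)
          rw [hc] at h
          rw [← sq_abs (c i), ← mul_pow, Real.norm_eq_abs]
          gcongr
      _ ≤ ρ ^ 2 * ‖u - w‖ ^ 2 := by
          rw [← Finset.mul_sum]
          gcongr
          exact he.sum_inner_products_le _
  have hel : ‖e l‖ = 1 := he.1 l
  set α := inner ℝ u (e l)
  have hdist : ‖u - α • e l‖ ≤ ‖u - c l • e l‖ := by
    refine abs_le_of_sq_le_sq' ?_ (by positivity) |>.2
    have hsq : ∀ t : ℝ, ‖u - t • e l‖ ^ 2 = 1 - 2 * t * α + t ^ 2 := by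
      intro t
      rw [norm_sub_sq_real, inner_smul_right, norm_smul, hu, hel, mul_one, Real.norm_eq_abs, sq_abs]
      ring
    rw [hsq, hsq]
    nlinarith [sq_nonneg (c l - α)]
  -- Source of the factor 2: rescaling `α • e l` to unit length costs no more than the distance from
  -- `u` to it. The sign normalization makes `‖α • e l‖ = α`.
  have hα : 1 - α ≤ ‖u - α • e l‖ := by
    have h := norm_sub_norm_le u (α • e l)
    rwa [norm_smul, hu, hel, mul_one, Real.norm_of_nonneg hsign] at h
  have hα1 : α ≤ 1 := by
    have h := real_inner_le_norm u (e l)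
    rwa [hu, hel, mul_one] at h
  calc ‖u - e l‖ = ‖(u - α • e l) - (1 - α) • e l‖ := by congr 1; module
    _ ≤ ‖u - α • e l‖ + ‖(1 - α) • e l‖ := norm_sub_le _ _
    _ = ‖u - α • e l‖ + (1 - α) := by
        rw [norm_smul, hel, mul_one, Real.norm_of_nonneg (by linarith)]
    _ ≤ 2 * ‖u - c l • e l‖ := by linarith
    _ = 2 * ‖(u - w) + (w - c l • e l)‖ := by congr 2; abel
    _ ≤ 2 * (‖u - w‖ + ρ * ‖u - w‖) := by
        have := norm_add_le (u - w) (w - c l • e l)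
        linarith
    _ = _ := by ring

variable [CompleteSpace H] {K : H →L[ℝ] H}

/-- `‖K (I - U)‖ ≤ d` whenever `‖(I - U) K*‖ ≤ d`. -/
theorem norm_map_sub_starProjection_le {U : Submodule ℝ H} [U.HasOrthogonalProjection] {d : ℝ}
    (hU : ∀ w, ‖K.adjoint w - U.starProjection (K.adjoint w)‖ ≤ d * ‖w‖) (v : H) :
    ‖K (v - U.starProjection v)‖ ≤ d * ‖v - U.starProjection v‖ := by
  set q := v - U.starProjection v with hq
  have h : ‖K q‖ * ‖K q‖ ≤ d * ‖q‖ * ‖K q‖ := by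
    calc ‖K q‖ * ‖K q‖ = inner ℝ q (K.adjoint (K q)) := by
          rw [ContinuousLinearMap.adjoint_inner_right, real_inner_self_eq_norm_mul_norm]
      _ = inner ℝ q (K.adjoint (K q) - U.starProjection (K.adjoint (K q))) :=
          inner_sub_starProjection U v _
      _ ≤ ‖q‖ * (d * ‖K q‖) := (real_inner_le_norm _ _).trans (by gcongr; exact hU _)
      _ = d * ‖q‖ * ‖K q‖ := by ring
  -- When `K q = 0` nothing can be cancelled; `hU q` then supplies `0 ≤ d * ‖q‖`, the sign of `d`
  -- not being assumed.
  rcases (norm_nonneg (K q)).eq_or_lt' with h0 | h0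
  · rw [h0]
    exact (norm_nonneg _).trans (hU q)
  · exact le_of_mul_le_mul_right h h0

/-- The image `K(U)` approximates `K v` at least as well as `d` times `U` approximates `v`. -/
theorem norm_map_sub_starProjection_map_le {U V : Submodule ℝ H} [U.HasOrthogonalProjection]
    [V.HasOrthogonalProjection] (hV : U.map (K : H →ₗ[ℝ] H) = V) {d : ℝ}
    (hU : ∀ w, ‖K.adjoint w - U.starProjection (K.adjoint w)‖ ≤ d * ‖w‖) (v : H) :
    ‖K v - V.starProjection (K v)‖ ≤ d * ‖v - U.starProjection v‖ := by
  have hmem : K (U.starProjection v) ∈ V :=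
    hV ▸ Submodule.mem_map_of_mem (U.starProjection_apply_mem v)
  refine (norm_sub_starProjection_le V (K v) hmem).trans ?_
  rw [← map_sub]
  exact norm_map_sub_starProjection_le hU v

/-- If `X` is invariant under `K K*` and the eigenvalues of `K K*` on the orthogonal complement of
`X` are at most `d²`, then `‖(I - X) K‖ ≤ d`. -/
theorem norm_map_sub_starProjection_le_of_eigenvalue_le
    (hK : IsCompactOperator (K ∘L K.adjoint))
    (X : Submodule ℝ H) [X.HasOrthogonalProjection] (hX : ∀ x ∈ X, K (K.adjoint x) ∈ X) {d : ℝ}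
    (hd : 0 ≤ d)
    (hle : ∀ (χ : H) (ν : ℝ), χ ∈ Xᗮ → χ ≠ 0 → ν ≠ 0 → K (K.adjoint χ) = ν • χ → ν ≤ d ^ 2)
    (w : H) : ‖K w - X.starProjection (K w)‖ ≤ d * ‖w‖ := by
  set Q : H →L[ℝ] H := Xᗮ.starProjection with hQ
  have hQapp : ∀ u, Q u = u - X.starProjection u := X.starProjection_orthogonal_val
  set L : H →L[ℝ] H := Q ∘L K with hL
  have hadj : L.adjoint = K.adjoint ∘L Q := by
    rw [hL, ContinuousLinearMap.adjoint_comp, (isSelfAdjoint_starProjection Xᗮ).adjoint_eq]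
  set T : H →L[ℝ] H := L ∘L L.adjoint with hT
  have hTself : IsSelfAdjoint T := by
    rw [ContinuousLinearMap.isSelfAdjoint_iff', hT, ContinuousLinearMap.adjoint_comp,
      ContinuousLinearMap.adjoint_adjoint]
  have hTapp : ∀ u, T u = Q (K (K.adjoint (Q u))) := fun u => by rw [hT, hadj]; rfl
  have hTcomp : IsCompactOperator T := by
    have h : T = Q ∘L (K ∘L K.adjoint) ∘L Q := ContinuousLinearMap.ext hTapp
    rw [h]
    exact (hK.comp_clm Q).clm_comp Q
  have hnorm : ‖T‖ = ‖L‖ ^ 2 := by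
    have h := ContinuousLinearMap.norm_adjoint_comp_self L.adjoint
    rw [ContinuousLinearMap.adjoint_adjoint, LinearIsometryEquiv.norm_map] at h
    rw [hT, h, sq]
  suffices hLd : ‖L‖ ≤ d by
    have h := (L.le_opNorm w).trans (mul_le_mul_of_nonneg_right hLd (norm_nonneg w))
    rwa [hL, ContinuousLinearMap.comp_apply, hQapp] at h
  refine abs_le_of_sq_le_sq' ?_ hd |>.2
  rw [← hnorm]
  rcases eq_or_ne T 0 with h0 | h0
  · rw [h0, norm_zero]; positivity
  have : Nontrivial (H →L[ℝ] H) := ⟨T, 0, h0⟩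
  have hrad := T.spectralRadius_eq_nnnorm hTself
  -- Over `ℝ` the spectrum could be empty, but then the spectral radius, which is `‖T‖` by
  -- self-adjointness, would vanish.
  have hne : (spectrum ℝ T).Nonempty := by
    by_contra hemp
    rw [Set.not_nonempty_iff_eq_empty] at hemp
    rw [spectralRadius, hemp] at hrad
    simp at hrad
    exact h0 (nnnorm_eq_zero.1 hrad.symm)
  obtain ⟨ν, hν, hνr⟩ := spectrum.exists_nnnorm_eq_spectralRadius_of_nonempty hne
  rw [hrad, ENNReal.coe_inj] at hνr
  have hνn : |ν| = ‖T‖ := congrArg NNReal.toReal hνr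
  have hν0 : ν ≠ 0 := by
    rintro rfl
    rw [abs_zero] at hνn
    exact h0 (norm_eq_zero.1 hνn.symm)
  obtain ⟨χ, hχ⟩ := ((hTcomp.hasEigenvalue_iff_mem_spectrum hν0).2 hν).exists_hasEigenvector
  have hχ0 : χ ≠ 0 := hχ.2
  have hTχ : T χ = ν • χ := hχ.apply_eq_smul
  have hχX : χ ∈ Xᗮ := by
    have : χ = ν⁻¹ • T χ := by rw [hTχ, inv_smul_smul₀ hν0]
    rw [this, hTapp]
    exact Submodule.smul_mem _ _ (Xᗮ.starProjection_apply_mem _)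
  have hQχ : Q χ = χ := Submodule.starProjection_eq_self_iff.2 hχX
  -- `K K*` is symmetric and preserves `X`, hence preserves `Xᗮ`; the projections in `T` act
  -- trivially on `χ`, which is thus an eigenvector of `K K*` itself.
  have hKX : K (K.adjoint χ) ∈ Xᗮ := by
    intro x hx
    rw [← ContinuousLinearMap.adjoint_inner_left K, ContinuousLinearMap.adjoint_inner_right K]
    exact hχX _ (hX x hx)
  have hKχ : K (K.adjoint χ) = ν • χ := by
    rw [← hTχ, hTapp, hQχ]
    exact (Submodule.starProjection_eq_self_iff.2 hKX).symm
  have hνpos : 0 ≤ ν := by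
    have h : ν * ‖χ‖ ^ 2 = ‖K.adjoint χ‖ ^ 2 := by
      rw [← real_inner_self_eq_norm_sq, ← real_inner_self_eq_norm_sq,
        ContinuousLinearMap.adjoint_inner_left, hKχ, inner_smul_right]
    by_contra hneg
    have h1 : 0 < ‖χ‖ ^ 2 := by positivity
    nlinarith [sq_nonneg ‖K.adjoint χ‖]
  rw [← hνn, abs_of_nonneg hνpos]
  exact hle χ ν hχX hχ0 hν0 hKχ

end Hilbert

/-! ### Exact eigenpairs as the spectrum of `K K*` -/

section Eigenpairs


variable {a b : ℝ} {K : L2 a b →L[ℝ] L2 a b}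

theorem HasWeakDeriv.const_smul {u w : L2 a b} (h : HasWeakDeriv u w) (c : ℝ) :
    HasWeakDeriv (c • u) (c • w) := by
  intro φ hφ hc hs
  have e : ∀ (v : L2 a b) (g : ℝ → ℝ),
      ∫ x, (c • v : L2 a b) x * g x ∂(vol a b) = c * ∫ x, v x * g x ∂(vol a b) := by
    intro v g
    rw [← integral_const_mul]
    refine integral_congr_ae ?_
    filter_upwards [Lp.coeFn_smul c v] with x hx
    rw [hx, Pi.smul_apply, smul_eq_mul, mul_assoc]
  rw [e, e, h φ hφ hc hs, mul_neg]

/-- By homogeneity: the class with `r = 0` already contains a normalized multiple of every `f ⟂ ker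
K`. -/
theorem DerivInverts.weakDeriv_map (hd : DerivInverts K) {f : L2 a b}
    (hf : ∀ w, K w = 0 → inner ℝ f w = 0) : weakDeriv (K f) = f := by
  have hunit : ‖f‖⁻¹ • f ∈ classAStar K 0 := by
    refine ⟨?_, fun w hw => ?_⟩
    · rw [unitBall, mem_closedBall_zero_iff, norm_smul, norm_inv, norm_norm]
      exact inv_mul_le_one
    · rw [inner_smul_left, hf w hw, mul_zero]
  have h := (hd.1 0 _ hunit).const_smul ‖f‖
  have e : ‖f‖ • ‖f‖⁻¹ • f = f := by
    rcases eq_or_ne f 0 with rfl | h0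
    · simp
    · exact smul_inv_smul₀ (norm_ne_zero_iff.2 h0) f
  rw [← map_smul, e] at h
  exact h.weakDeriv_eq

theorem inner_dual_eq_zero (g w : L2 a b) (hw : K w = 0) : inner ℝ (dual K g) w = 0 := by
  rw [ContinuousLinearMap.adjoint_inner_left, hw, inner_zero_right]

theorem exists_orthogonal_ker_preimage (v : L2 a b)
    (hv : v ∈ LinearMap.range (K : L2 a b →ₗ[ℝ] L2 a b)) :
    ∃ g, (∀ w, K w = 0 → inner ℝ g w = 0) ∧ K g = v := by
  obtain ⟨f, rfl⟩ := hv
  set N : Submodule ℝ (L2 a b) := K.ker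
  refine ⟨f - N.starProjection f, fun w hw => N.starProjection_inner_eq_zero f w hw, ?_⟩
  have h : K (N.starProjection f) = 0 := N.starProjection_apply_mem f
  rw [map_sub, h, sub_zero]
  rfl

/-- With `ψ = K f`, `f ⟂ ker K`, the residual `q = f - m K*ψ` is also orthogonal to `ker K`. Testing
with `v = K q` gives `(f, q) = m (K*ψ, q)`, that is, `‖q‖² = 0`. -/
theorem IsEigenpair.weakDeriv_eq (hd : DerivInverts K) {m : ℝ} {ψ : L2 a b}
    (h : IsEigenpair (LinearMap.range (K : L2 a b →ₗ[ℝ] L2 a b)) m ψ) :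
    weakDeriv ψ = m • dual K ψ := by
  obtain ⟨f, hf, rfl⟩ := exists_orthogonal_ker_preimage ψ h.1
  rw [hd.weakDeriv_map hf, ← sub_eq_zero, ← inner_self_eq_zero (𝕜 := ℝ)]
  set q := f - m • dual K (K f)
  have hq : ∀ w, K w = 0 → inner ℝ q w = 0 := by
    intro w hw
    rw [inner_sub_left, hf w hw, inner_smul_left, inner_dual_eq_zero _ _ hw, mul_zero, sub_zero]
  have h1 := h.2.2 (K q) ⟨q, rfl⟩
  rw [hd.weakDeriv_map hf, hd.weakDeriv_map hq] at h1
  change inner ℝ (f - m • dual K (K f)) q = 0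
  rw [inner_sub_left, h1, inner_smul_left, ContinuousLinearMap.adjoint_inner_left]
  simp

theorem IsEigenpair.eq_smul (hd : DerivInverts K) {m : ℝ} {ψ : L2 a b}
    (h : IsEigenpair (LinearMap.range (K : L2 a b →ₗ[ℝ] L2 a b)) m ψ) :
    ψ = m • K (dual K ψ) := by
  have h1 := h.weakDeriv_eq hd
  obtain ⟨f, hf, rfl⟩ := exists_orthogonal_ker_preimage ψ h.1
  rw [hd.weakDeriv_map hf] at h1
  rw [← map_smul, ← h1]

theorem IsEigenpair.norm_sq_eq (hd : DerivInverts K) {m : ℝ} {ψ : L2 a b}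
    (h : IsEigenpair (LinearMap.range (K : L2 a b →ₗ[ℝ] L2 a b)) m ψ) :
    ‖ψ‖ ^ 2 = m * ‖dual K ψ‖ ^ 2 := by
  calc ‖ψ‖ ^ 2 = inner ℝ ψ (m • K (dual K ψ)) := by
        rw [← h.eq_smul hd, real_inner_self_eq_norm_sq]
    _ = m * ‖dual K ψ‖ ^ 2 := by
        rw [inner_smul_right, ← ContinuousLinearMap.adjoint_inner_left, real_inner_self_eq_norm_sq]

theorem IsEigenpair.pos (hd : DerivInverts K) {m : ℝ} {ψ : L2 a b}
    (h : IsEigenpair (LinearMap.range (K : L2 a b →ₗ[ℝ] L2 a b)) m ψ) : 0 < m := by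
  have h1 := h.norm_sq_eq hd
  have h2 : 0 < ‖ψ‖ ^ 2 := by have := norm_pos_iff.2 h.2.1; positivity
  by_contra hm
  nlinarith [sq_nonneg ‖dual K ψ‖]

theorem IsEigenpair.map_dual (hd : DerivInverts K) {m : ℝ} {ψ : L2 a b}
    (h : IsEigenpair (LinearMap.range (K : L2 a b →ₗ[ℝ] L2 a b)) m ψ) :
    K (dual K ψ) = m⁻¹ • ψ := by
  nth_rw 2 [h.eq_smul hd]
  rw [inv_smul_smul₀ (h.pos hd).ne']

theorem DerivInverts.isEigenpair (hd : DerivInverts K) {ν : ℝ} {χ : L2 a b} (hχ : χ ≠ 0)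
    (hν : ν ≠ 0) (h : K (dual K χ) = ν • χ) :
    IsEigenpair (LinearMap.range (K : L2 a b →ₗ[ℝ] L2 a b)) ν⁻¹ χ := by
  have e : K (ν⁻¹ • dual K χ) = χ := by rw [map_smul, h, inv_smul_smul₀ hν]
  have hdχ : weakDeriv χ = ν⁻¹ • dual K χ := by
    have h1 := hd.weakDeriv_map (f := ν⁻¹ • dual K χ) fun w hw => by
      rw [inner_smul_left, inner_dual_eq_zero _ _ hw, mul_zero]
    rwa [e] at h1
  refine ⟨⟨_, e⟩, hχ, fun v hv => ?_⟩
  obtain ⟨g, hg, rfl⟩ := exists_orthogonal_ker_preimage v hv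
  rw [hd.weakDeriv_map hg, hdχ, inner_smul_left, ContinuousLinearMap.adjoint_inner_left]
  rfl

/-- Eigenvalues of `K K*` on the complement of the first `n` of `n + 1` eigenfunctions are bounded
by the reciprocal of the last of the `n + 1` eigenvalues. -/
theorem IsFirstEigenpairs.le_inv_last (hd : DerivInverts K) {n : ℕ} {μ : Fin (n + 1) → ℝ}
    {ψ : Fin (n + 1) → L2 a b}
    (hμ : IsFirstEigenpairs (LinearMap.range (K : L2 a b →ₗ[ℝ] L2 a b)) (n + 1) μ ψ)
    {ν : ℝ} {χ : L2 a b} (hχ : χ ≠ 0) (hν : ν ≠ 0) (h : K (dual K χ) = ν • χ)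
    (hperp : ∀ i : Fin n, inner ℝ (ψ i.castSucc) χ = 0) : ν ≤ (μ (Fin.last n))⁻¹ := by
  have hχe := hd.isEigenpair hχ hν h
  have hlast := hμ.eigenpair (Fin.last n)
  -- `first` only concerns eigenfunctions orthogonal to all `n + 1` of the `ψ i`. If `χ` is not
  -- orthogonal to the last one, symmetry of `K K*` forces the two eigenvalues to coincide.
  by_cases h0 : inner ℝ (ψ (Fin.last n)) χ = 0
  · have h1 := hμ.first _ _ hχe (fun i => Fin.lastCases h0 hperp i) (Fin.last n)
    have h2 := inv_anti₀ (hlast.pos hd) h1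
    rwa [inv_inv] at h2
  · refine le_of_eq (mul_right_cancel₀ h0 ?_)
    calc ν * inner ℝ (ψ (Fin.last n)) χ = inner ℝ (ψ (Fin.last n)) (K (dual K χ)) := by
          rw [h, inner_smul_right]
      _ = inner ℝ (K (dual K (ψ (Fin.last n)))) χ := by
          rw [← ContinuousLinearMap.adjoint_inner_left K, ContinuousLinearMap.adjoint_inner_right K]
      _ = (μ (Fin.last n))⁻¹ * inner ℝ (ψ (Fin.last n)) χ := by
          rw [hlast.map_dual hd, inner_smul_left]
          rfl

theorem distTo_image_le_iff {T : L2 a b →L[ℝ] L2 a b} {X : Submodule ℝ (L2 a b)}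
    [FiniteDimensional ℝ X] {d : ℝ} (hd : 0 ≤ d) :
    distTo (T '' unitBall a b) X ≤ ENNReal.ofReal d ↔
      ∀ w, ‖T w - X.starProjection (T w)‖ ≤ d * ‖w‖ := by
  have e : ∀ u : L2 a b, ‖u‖ₑ ≤ ENNReal.ofReal d ↔ ‖u‖ ≤ d := fun u => by
    rw [← ofReal_norm, ENNReal.ofReal_le_ofReal_iff hd]
  simp only [distTo, iSup_le_iff, e, forall_mem_image]
  constructor
  · intro h w
    rcases eq_or_ne w 0 with rfl | h0
    · simp
    have hn : 0 < ‖w‖ := norm_pos_iff.2 h0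
    have h1 := h (x := ‖w‖⁻¹ • w) (by
      rw [unitBall, mem_closedBall_zero_iff, norm_smul, norm_inv, norm_norm]
      exact inv_mul_le_one)
    rw [map_smul, map_smul, ← smul_sub, norm_smul, norm_inv, norm_norm,
      inv_mul_le_iff₀ hn] at h1
    linarith
  · intro h w hw
    rw [unitBall, mem_closedBall_zero_iff] at hw
    exact (h w).trans (mul_le_of_le_one_right hd hw)

/-- An optimal space does at least as well as any `n`-dimensional competitor, so only upper bounds
on widths are needed. -/
theorem IsOptimal.norm_sub_le {T : L2 a b →L[ℝ] L2 a b} {X Z : Submodule ℝ (L2 a b)}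
    [FiniteDimensional ℝ X] [FiniteDimensional ℝ Z] {n : ℕ} (hX : IsOptimal n (T '' unitBall a b) X)
    (hZ : Module.finrank ℝ Z = n) {d : ℝ} (hd : 0 ≤ d)
    (h : ∀ w, ‖T w - Z.starProjection (T w)‖ ≤ d * ‖w‖) (w : L2 a b) :
    ‖T w - X.starProjection (T w)‖ ≤ d * ‖w‖ := by
  refine (distTo_image_le_iff hd).1 ?_ w
  rw [← hX.2]
  exact (iInf₂_le_of_le Z ‹_› (iInf_le _ hZ)).trans ((distTo_image_le_iff hd).2 h)

/-! ### Upper bounds for the widths of `A` and `A_*` -/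

section Width

variable {n : ℕ} {μ : Fin (n + 1) → ℝ} {ψ : Fin (n + 1) → L2 a b}

theorem IsFirstEigenpairs.norm_sub_starProjection_le (hd : DerivInverts K)
    (hK : IsCompactOperator K)
    (hμ : IsFirstEigenpairs (LinearMap.range (K : L2 a b →ₗ[ℝ] L2 a b)) (n + 1) μ ψ)
    {X : Submodule ℝ (L2 a b)} [FiniteDimensional ℝ X]
    (hX : IsOptimal n (classA K 1) X) (w : L2 a b) :
    ‖K w - X.starProjection (K w)‖ ≤ √(μ (Fin.last n))⁻¹ * ‖w‖ := by
  have hpos : ∀ i, 0 < μ i := fun i => (hμ.eigenpair i).pos hd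
  have horth : Orthonormal ℝ fun i : Fin n => ψ i.castSucc :=
    hμ.orthonormal.comp _ (Fin.castSucc_injective n)
  set Z := Submodule.span ℝ (range fun i : Fin n => ψ i.castSucc)
  have : FiniteDimensional ℝ Z := FiniteDimensional.span_of_finite ℝ (finite_range _)
  have hdim : Module.finrank ℝ Z = n := by
    rw [finrank_span_eq_card horth.linearIndependent, Fintype.card_fin]
  refine IsOptimal.norm_sub_le hX hdim (Real.sqrt_nonneg _) ?_ w
  refine norm_map_sub_starProjection_le_of_eigenvalue_le (hK.comp_clm (dual K)) Z
    (fun x hx => ?_) (Real.sqrt_nonneg _) fun χ ν hχ hχ0 hν h => ?_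
  · have hle : Z ≤ Z.comap (K ∘L dual K : L2 a b →ₗ[ℝ] L2 a b) := by
      refine Submodule.span_le.2 ?_
      rintro _ ⟨i, rfl⟩
      change K (dual K (ψ i.castSucc)) ∈ Z
      rw [(hμ.eigenpair _).map_dual hd]
      exact Z.smul_mem _ (Submodule.subset_span ⟨i, rfl⟩)
    exact hle hx
  · rw [Real.sq_sqrt (inv_nonneg.2 (hpos _).le)]
    exact hμ.le_inv_last hd hχ0 hν h fun i => hχ _ (Submodule.subset_span ⟨i, rfl⟩)

/-- The competitor is the span of the `K* ψ i`, independent because `K` sends them to nonzero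
multiples of the `ψ i`. An eigenvector `χ` of `K* K` orthogonal to it yields the eigenvector `K χ`
of `K K*`, orthogonal to the `ψ i`. -/
theorem IsFirstEigenpairs.norm_dual_sub_starProjection_le (hd : DerivInverts K)
    (hK : IsCompactOperator K)
    (hμ : IsFirstEigenpairs (LinearMap.range (K : L2 a b →ₗ[ℝ] L2 a b)) (n + 1) μ ψ)
    {Y : Submodule ℝ (L2 a b)} [FiniteDimensional ℝ Y]
    (hY : IsOptimal n (classAStar K 1) Y) (w : L2 a b) :
    ‖dual K w - Y.starProjection (dual K w)‖ ≤ √(μ (Fin.last n))⁻¹ * ‖w‖ := by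
  have hpos : ∀ i, 0 < μ i := fun i => (hμ.eigenpair i).pos hd
  have horth : Orthonormal ℝ fun i : Fin n => ψ i.castSucc :=
    hμ.orthonormal.comp _ (Fin.castSucc_injective n)
  have hlin : LinearIndependent ℝ fun i : Fin n => dual K (ψ i.castSucc) := by
    refine LinearIndependent.of_comp (K : L2 a b →ₗ[ℝ] L2 a b) ?_
    have e : (K : L2 a b →ₗ[ℝ] L2 a b) ∘ (fun i : Fin n => dual K (ψ i.castSucc)) =
        (fun i : Fin n => Units.mk0 (μ i.castSucc)⁻¹ (inv_ne_zero (hpos _).ne')) •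
          fun i : Fin n => ψ i.castSucc :=
      funext fun i => (hμ.eigenpair _).map_dual hd
    rw [e]
    exact horth.linearIndependent.units_smul _
  set Z := Submodule.span ℝ (range fun i : Fin n => dual K (ψ i.castSucc))
  have : FiniteDimensional ℝ Z := FiniteDimensional.span_of_finite ℝ (finite_range _)
  have hdim : Module.finrank ℝ Z = n := by
    rw [finrank_span_eq_card hlin, Fintype.card_fin]
  refine IsOptimal.norm_sub_le hY hdim (Real.sqrt_nonneg _) ?_ w
  refine norm_map_sub_starProjection_le_of_eigenvalue_le
    (by rw [ContinuousLinearMap.adjoint_adjoint]; exact hK.clm_comp (dual K)) Z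
    (fun x hx => ?_) (Real.sqrt_nonneg _) fun χ ν hχ hχ0 hν h => ?_
  · have hle : Z ≤ Z.comap (dual K ∘L K : L2 a b →ₗ[ℝ] L2 a b) := by
      refine Submodule.span_le.2 ?_
      rintro _ ⟨i, rfl⟩
      change dual K (K (dual K (ψ i.castSucc))) ∈ Z
      rw [(hμ.eigenpair _).map_dual hd, map_smul]
      exact Z.smul_mem _ (Submodule.subset_span ⟨i, rfl⟩)
    rw [ContinuousLinearMap.adjoint_adjoint]
    exact hle hx
  · rw [Real.sq_sqrt (inv_nonneg.2 (hpos _).le)]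
    rw [ContinuousLinearMap.adjoint_adjoint] at h
    refine hμ.le_inv_last hd (χ := K χ) (fun h0 => ?_) hν (by rw [h, map_smul]) fun i => ?_
    · rw [h0, map_zero] at h
      exact smul_ne_zero hν hχ0 h.symm
    · rw [← ContinuousLinearMap.adjoint_inner_left]
      exact hχ _ (Submodule.subset_span ⟨i, rfl⟩)

end Width

end Eigenpairs


/-! ### Error propagation through `X_p`, `Y_p` and the Ritz projection -/

section Spaces

variable {a b : ℝ} {K : L2 a b →L[ℝ] L2 a b} {X₀ Y₀ : Submodule ℝ (L2 a b)}

theorem inner_spaceY_eq_zero (hY₀ : ∀ u ∈ Y₀, ∀ w, K w = 0 → inner ℝ u w = 0) (p : ℕ) :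
    ∀ u ∈ spaceY K X₀ Y₀ p, ∀ w, K w = 0 → inner ℝ u w = 0 := by
  cases p with
  | zero => exact hY₀
  | succ p =>
    rintro _ ⟨x, -, rfl⟩ w hw
    exact inner_dual_eq_zero x w hw

variable [FiniteDimensional ℝ X₀] [FiniteDimensional ℝ Y₀]

theorem finrank_spaces_le {n : ℕ} (hX : Module.finrank ℝ X₀ ≤ n) (hY : Module.finrank ℝ Y₀ ≤ n)
    (p : ℕ) : Module.finrank ℝ (spaceX K X₀ Y₀ p) ≤ n ∧
      Module.finrank ℝ (spaceY K X₀ Y₀ p) ≤ n := by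
  induction p with
  | zero => exact ⟨hX, hY⟩
  | succ p ih =>
    have hfin := spaces_finiteDimensional K X₀ Y₀ p
    have := hfin.1
    have := hfin.2
    exact ⟨(Submodule.finrank_map_le _ (spaces K X₀ Y₀ p).2).trans ih.2,
      (Submodule.finrank_map_le _ (spaces K X₀ Y₀ p).1).trans ih.1⟩

theorem ritzX_mem {p : ℕ} (hp : 1 ≤ p) (u : L2 a b) :
    ritzX K X₀ Y₀ p u ∈ spaceX K X₀ Y₀ p := by
  obtain ⟨q, rfl⟩ := Nat.exists_eq_add_of_le' hp
  exact ⟨_, (spaceY K X₀ Y₀ q).starProjection_apply_mem (weakDeriv u), rfl⟩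

variable {d : ℝ}

/-- The constant `d` does not deteriorate with `p`: duality passes the bound from `Y_p` to `X_{p+1}`
and from `X_p` to `Y_{p+1}`. -/
theorem norm_sub_spaces_le
    (hX : ∀ w, ‖K w - X₀.starProjection (K w)‖ ≤ d * ‖w‖)
    (hY : ∀ w, ‖dual K w - Y₀.starProjection (dual K w)‖ ≤ d * ‖w‖) (hd : 0 ≤ d) (p : ℕ) :
    (∀ w, ‖K w - (spaceX K X₀ Y₀ p).starProjection (K w)‖ ≤ d * ‖w‖) ∧
      ∀ w, ‖dual K w - (spaceY K X₀ Y₀ p).starProjection (dual K w)‖ ≤ d * ‖w‖ := by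
  induction p with
  | zero => exact ⟨hX, hY⟩
  | succ p ih =>
    refine ⟨fun w => ?_, fun w => ?_⟩
    · refine (norm_map_sub_starProjection_map_le (U := spaceY K X₀ Y₀ p)
        (V := spaceX K X₀ Y₀ (p + 1)) rfl ih.2 w).trans ?_
      gcongr
      exact norm_sub_starProjection_le_norm _ _
    · refine (norm_map_sub_starProjection_map_le (K := dual K) (U := spaceX K X₀ Y₀ p)
        (V := spaceY K X₀ Y₀ (p + 1)) rfl
        (by rw [ContinuousLinearMap.adjoint_adjoint]; exact ih.1) w).trans ?_
      gcongr
      exact norm_sub_starProjection_le_norm _ _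

/-- The errors for a pair `ψ = s K φ`, `φ = s K* ψ` of unit singular functions. -/
theorem norm_singular_sub_spaces_le
    (hX : ∀ w, ‖K w - X₀.starProjection (K w)‖ ≤ d * ‖w‖)
    (hY : ∀ w, ‖dual K w - Y₀.starProjection (dual K w)‖ ≤ d * ‖w‖) (hd : 0 ≤ d)
    {s : ℝ} (hs : 0 ≤ s) {ψ φ : L2 a b} (hψ : ψ = s • K φ) (hφ : φ = s • dual K ψ)
    (hψ1 : ‖ψ‖ = 1) (hφ1 : ‖φ‖ = 1) (p : ℕ) :
    ‖ψ - (spaceX K X₀ Y₀ p).starProjection ψ‖ ≤ (s * d) ^ (p + 1) ∧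
      ‖φ - (spaceY K X₀ Y₀ p).starProjection φ‖ ≤ (s * d) ^ (p + 1) := by
  have hscale : ∀ (U : Submodule ℝ (L2 a b)) [U.HasOrthogonalProjection] (v : L2 a b),
      ‖s • v - U.starProjection (s • v)‖ = s * ‖v - U.starProjection v‖ := by
    intro U _ v
    rw [map_smul, ← smul_sub, norm_smul, Real.norm_of_nonneg hs]
  induction p with
  | zero =>
    constructor
    · rw [hψ, hscale]
      have h := hX φ
      rw [hφ1, mul_one] at h
      rw [zero_add, pow_one]
      exact mul_le_mul_of_nonneg_left h hs
    · rw [hφ, hscale]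
      have h := hY ψ
      rw [hψ1, mul_one] at h
      rw [zero_add, pow_one]
      exact mul_le_mul_of_nonneg_left h hs
  | succ p ih =>
    have happ := norm_sub_spaces_le hX hY hd p
    constructor
    · rw [hψ, hscale, pow_succ', mul_assoc]
      gcongr
      refine (norm_map_sub_starProjection_map_le (U := spaceY K X₀ Y₀ p)
        (V := spaceX K X₀ Y₀ (p + 1)) rfl happ.2 φ).trans ?_
      gcongr
      exact ih.2
    · rw [hφ, hscale, pow_succ', mul_assoc]
      gcongr
      refine (norm_map_sub_starProjection_map_le (K := dual K) (U := spaceX K X₀ Y₀ p)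
        (V := spaceY K X₀ Y₀ (p + 1)) rfl
        (by rw [ContinuousLinearMap.adjoint_adjoint]; exact happ.1) ψ).trans ?_
      gcongr
      exact ih.1

theorem norm_sub_ritzX_le (hder : DerivInverts K)
    (hX : ∀ w, ‖K w - X₀.starProjection (K w)‖ ≤ d * ‖w‖)
    (hY : ∀ w, ‖dual K w - Y₀.starProjection (dual K w)‖ ≤ d * ‖w‖) (hd : 0 ≤ d)
    {m : ℝ} {ψ : L2 a b} (h : IsEigenpair (LinearMap.range (K : L2 a b →ₗ[ℝ] L2 a b)) m ψ)
    (hψ1 : ‖ψ‖ = 1) {p : ℕ} (hp : 1 ≤ p) :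
    ‖ψ - ritzX K X₀ Y₀ p ψ‖ ≤ (√m * d) ^ (p + 1) := by
  obtain ⟨q, rfl⟩ := Nat.exists_eq_add_of_le' hp
  have hm : √m * √m = m := Real.mul_self_sqrt (h.pos hder).le
  set φ := √m • dual K ψ with hφ
  have hψ : ψ = √m • K φ := by
    rw [hφ, map_smul, smul_smul, hm]
    exact h.eq_smul hder
  have hφ1 : ‖φ‖ = 1 := by
    have h1 := h.norm_sq_eq hder
    rw [hψ1, one_pow] at h1
    have h2 : ‖φ‖ ^ 2 = 1 := by
      rw [hφ, norm_smul, mul_pow, Real.norm_eq_abs, sq_abs, sq, hm, ← h1]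
    exact (pow_eq_one_iff_of_nonneg (norm_nonneg φ) two_ne_zero).1 h2
  have hdψ : weakDeriv ψ = √m • φ := by
    rw [h.weakDeriv_eq hder, hφ, smul_smul, hm]
  -- With `p = q + 1`, the error of `φ` in `Y_q` has exponent `q + 1 = p`; the outer `√m • K (I -
  -- Y_q)` contributes the last factor.
  have e : ψ - ritzX K X₀ Y₀ (q + 1) ψ =
      √m • K (φ - (spaceY K X₀ Y₀ q).starProjection φ) := by
    change ψ - K ((spaceY K X₀ Y₀ q).starProjection (weakDeriv ψ)) = _
    rw [hdψ, map_smul, map_smul, map_sub, smul_sub, ← hψ]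
  rw [e, norm_smul, Real.norm_of_nonneg (Real.sqrt_nonneg m), pow_succ', mul_assoc]
  gcongr
  refine (norm_map_sub_starProjection_le (norm_sub_spaces_le hX hY hd q).2 φ).trans ?_
  gcongr
  exact (norm_singular_sub_spaces_le hX hY hd (Real.sqrt_nonneg m) hψ hφ hψ1 hφ1 q).2

/-- Galerkin orthogonality of the Ritz projection, tested with a discrete eigenfunction. -/
theorem inner_ritzX_eq (hder : DerivInverts K)
    (hY₀ : ∀ u ∈ Y₀, ∀ w, K w = 0 → inner ℝ u w = 0) {p : ℕ} (hp : 1 ≤ p)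
    {m m' : ℝ} {ψ χ : L2 a b} (h : IsEigenpair (LinearMap.range (K : L2 a b →ₗ[ℝ] L2 a b)) m ψ)
    (h' : IsEigenpair (spaceX K X₀ Y₀ p) m' χ) :
    m' * inner ℝ χ (ritzX K X₀ Y₀ p ψ) = m * inner ℝ χ ψ := by
  obtain ⟨q, rfl⟩ := Nat.exists_eq_add_of_le' hp
  obtain ⟨g, hg, hgχ⟩ := h'.1
  replace hgχ : K g = χ := hgχ
  set U := spaceY K X₀ Y₀ q
  set f := weakDeriv ψ with hf
  have hU := inner_spaceY_eq_zero (X₀ := X₀) hY₀ q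
  have hPf : U.starProjection f ∈ U := U.starProjection_apply_mem f
  have h1 := h'.2.2 (K (U.starProjection f)) ⟨_, hPf, rfl⟩
  have h2 := h.2.2 χ ⟨g, hgχ⟩
  have hdχ : weakDeriv χ = g := hgχ ▸ hder.weakDeriv_map (hU g hg)
  rw [hdχ, hder.weakDeriv_map (hU _ hPf)] at h1
  rw [hdχ, ← hf] at h2
  have h3 : inner ℝ g (U.starProjection f) = inner ℝ f g := by
    rw [← U.inner_starProjection_left_eq_right, U.starProjection_eq_self_iff.2 hg, real_inner_comm]
  rw [real_inner_comm ψ χ, ← h2, ← h3, h1]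
  rfl

end Spaces

/-- A real supremum dominates its terms only if bounded above; here the index type is finite. -/
theorem le_separationConst {n : ℕ} (m : ℝ) (μp : Fin n → ℝ) (l : Fin n) {i : Fin n} (hi : i ≠ l) :
    m / |m - μp i| ≤ separationConst m μp l :=
  le_ciSup (f := fun i : {i : Fin n // i ≠ l} => m / |m - μp i|) (finite_range _).bddAbove ⟨i, hi⟩

theorem separationConst_nonneg {n : ℕ} {m : ℝ} (hm : 0 ≤ m) (μp : Fin n → ℝ) (l : Fin n) :
    0 ≤ separationConst m μp l :=
  Real.iSup_nonneg fun _ => by positivity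

end Galerkin

end

/-! ### The eigenfunction error estimate -/

theorem mainTheorem6
    -- the integral operator with kernel k on L²(a, b)
    (a b : ℝ) (hab : a < b) (k : ℝ → ℝ → ℝ) (hk : Galerkin.IsKernel a b k)
    (K : Galerkin.L2 a b →L[ℝ] Galerkin.L2 a b) (hK : K = Galerkin.integralOp k hk)
    (hd : Galerkin.DerivInverts K)
    -- the initial spaces
    (n : ℕ) (X₀ Y₀ : Submodule ℝ (Galerkin.L2 a b))
    [FiniteDimensional ℝ X₀] [FiniteDimensional ℝ Y₀]
    (hX₀ : ∀ u ∈ X₀, ∀ w, Galerkin.dual K w = 0 → inner ℝ u w = 0)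
    (hY₀ : ∀ u ∈ Y₀, ∀ w, K w = 0 → inner ℝ u w = 0)
    (hXopt : Galerkin.IsOptimal n (Galerkin.classA K 1) X₀)
    (hYopt : Galerkin.IsOptimal n (Galerkin.classAStar K 1) Y₀)
    (p : ℕ) (hp : 1 ≤ p)
    -- the first n + 1 exact eigenvalues, which are distinct, and their eigenfunctions
    (μ : Fin (n + 1) → ℝ) (ψ : Fin (n + 1) → Galerkin.L2 a b)
    (hμ : Galerkin.IsFirstEigenpairs
      (LinearMap.range (K : Galerkin.L2 a b →ₗ[ℝ] Galerkin.L2 a b)) (n + 1) μ ψ)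
    (hsimple : StrictMono μ)
    -- the first n discrete eigenvalues and eigenfunctions
    (μp : Fin n → ℝ) (ψp : Fin n → Galerkin.L2 a b)
    (hμp : Galerkin.IsFirstEigenpairs (Galerkin.spaceX K X₀ Y₀ p) n μp ψp)
    -- the index, the sign normalization, and the finiteness of the separation constant
    (l : Fin n) (hsign : 0 ≤ inner ℝ (ψ l.castSucc) (ψp l))
    (hsep : ∀ i, i ≠ l → μp i ≠ μ l.castSucc) :
    ‖ψ l.castSucc - ψp l‖ ≤
        2 * (1 + Galerkin.separationConst (μ l.castSucc) μp l) *
          ‖ψ l.castSucc - Galerkin.ritzX K X₀ Y₀ p (ψ l.castSucc)‖ ∧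
      2 * (1 + Galerkin.separationConst (μ l.castSucc) μp l) *
          ‖ψ l.castSucc - Galerkin.ritzX K X₀ Y₀ p (ψ l.castSucc)‖ ≤
        2 * (1 + Galerkin.separationConst (μ l.castSucc) μp l) *
          (μ l.castSucc / μ (Fin.last n)) ^ (((p : ℝ) + 1) / 2) := by

  have hψ := hμ.eigenpair l.castSucc
  have hm := hψ.pos hd
  have hlast := (hμ.eigenpair (Fin.last n)).pos hd
  have hunit : ‖ψ l.castSucc‖ = 1 := hμ.orthonormal.1 _
  have hcomp : IsCompactOperator K := hK ▸ Galerkin.isCompactOperator_integralOp k hk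
  have hρ := Galerkin.separationConst_nonneg hm.le μp l
  set ρ := Galerkin.separationConst (μ l.castSucc) μp l
  have hritz : Galerkin.ritzX K X₀ Y₀ p (ψ l.castSucc) ∈ Galerkin.spaceX K X₀ Y₀ p :=
    Galerkin.ritzX_mem hp _
  set w := Galerkin.ritzX K X₀ Y₀ p (ψ l.castSucc)
  constructor
  · refine Galerkin.norm_sub_le_of_coeff_le hμp.orthonormal l hunit ?_ hρ (fun i hi => ?_) hsign
    -- `X_p` has dimension at most `n` and contains `n` orthonormal vectors, so they span it.
    · have hle : Submodule.span ℝ (range ψp) ≤ Galerkin.spaceX K X₀ Y₀ p :=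
        Submodule.span_le.2 (range_subset_iff.2 fun i => (hμp.eigenpair i).1)
      have hdim : Module.finrank ℝ (Galerkin.spaceX K X₀ Y₀ p) ≤
          Module.finrank ℝ (Submodule.span ℝ (range ψp)) := by
        rw [finrank_span_eq_card hμp.orthonormal.linearIndependent, Fintype.card_fin]
        exact (Galerkin.finrank_spaces_le hXopt.1 hYopt.1 p).1
      rwa [Submodule.eq_of_le_of_finrank_le hle hdim]
    · have hgal : μp i * inner ℝ (ψp i) w = μ l.castSucc * inner ℝ (ψp i) (ψ l.castSucc) :=
        Galerkin.inner_ritzX_eq hd hY₀ hp hψ (hμp.eigenpair i)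
      have hgap : 0 < |μ l.castSucc - μp i| := abs_pos.2 (sub_ne_zero.2 (hsep i hi).symm)
      refine le_trans ?_ (mul_le_mul_of_nonneg_right
        (Galerkin.le_separationConst (μ l.castSucc) μp l hi) (abs_nonneg _))
      rw [div_mul_eq_mul_div, le_div_iff₀ hgap]
      conv_rhs => rw [← abs_of_pos hm]
      -- After the sign flip both absolute values have equal arguments: this is the Galerkin
      -- identity with `μ_l (ψ_{p,i}, Rψ_l)` subtracted.
      rw [← abs_mul, ← abs_mul, inner_sub_right, ← abs_neg]
      refine le_of_eq (congrArg _ ?_)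
      linear_combination hgal
  · have h := Galerkin.norm_sub_ritzX_le hd (hμ.norm_sub_starProjection_le hd hcomp hXopt)
      (hμ.norm_dual_sub_starProjection_le hd hcomp hYopt) (Real.sqrt_nonneg _) hψ hunit hp
    refine mul_le_mul_of_nonneg_left (h.trans_eq ?_) (by positivity)
    rw [← Real.sqrt_mul hm.le, ← div_eq_mul_inv, Real.sqrt_eq_rpow, ← Real.rpow_natCast,
      ← Real.rpow_mul (div_nonneg hm.le hlast.le)]
    congr 1
    push_cast
    ring
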